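/- Let $K$ be a field of characteristic $p>0$, and let $a=(a(n))_{n\in\mathbb{N}}$, $\mathbb{N}=\{0,1,2,\dots\}$, be a sequence in $K$ that is a linear recurrence sequence of order $d$; that is, $d$ is the smallest nonnegative integer for which there exist $\gamma_0,\dots,\gamma_{d-1}\in K$ with $$a(n+d)=\gamma_{d-1}a(n+d-1)+\gamma_{d-2}a(n+d-2)+\cdots+\gamma_0a(n)\qquad\text{for all } n\in\mathbb{N}.$$ Let $\mathcal{Z}(a)=\{n\in\mathbb{N} : a(n)=0\}$, and for $S\subseteq\mathbb{N}$ and $n\in\mathbb{N}$ put $$\delta_S(n)=\max_{m\in\mathbb{N}}\,\bigl|S\cap\{m,m+1,\dots,m+n-1\}\bigr|.$$ If $\mathcal{Z}(a)$ contains no infinite arithmetic progression, i.e. no set of the form $m+k\mathbb{N}$ with $m,k\in\mathbb{N}$ and $k\geq 1$, then $$\delta_{\mathcal{Z}(a)}(n)=O\bigl((\log n)^{d-2}\bigr)\qquad (n\to\infty).$$ -/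

import Mathlib

open Filter Asymptotics

/-- The sequence `a` satisfies a linear recurrence relation of order `d` over `K`:
there are `γ₀, …, γ_{d-1}` in `K` with `a (n + d) = ∑ i < d, γ i * a (n + i)` for all `n`. -/
def SatisfiesRecurrence {K : Type*} [Field K] (a : ℕ → K) (d : ℕ) : Prop :=
  ∃ E : LinearRecurrence K, E.order = d ∧ E.IsSolution a

/-- `a` is a `K`-recurrence sequence of order `d`: `d` is the smallest nonnegative integer such
that `a` satisfies a linear recurrence relation of order `d`. -/
def IsRecurrenceSeqOfOrder {K : Type*} [Field K] (a : ℕ → K) (d : ℕ) : Prop :=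
  IsLeast {e : ℕ | SatisfiesRecurrence a e} d

/-- The set of zeroes of a sequence. -/
def zeroSet {K : Type*} [Field K] (a : ℕ → K) : Set ℕ := {n : ℕ | a n = 0}

/-- Infinite arithmetic progressions `m + n ℕ` with `n` positive. -/
def IsInfiniteArithProg (T : Set ℕ) : Prop :=
  ∃ m n : ℕ, 0 < n ∧ T = Set.range (fun i : ℕ => m + n * i)

/-- `windowMax S n` is the maximum over `m` of the number of elements of `S` in the window
`{m, m + 1, …, m + n - 1}`. -/
noncomputable def windowMax (S : Set ℕ) (n : ℕ) : ℕ :=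
  ⨆ m : ℕ, (S ∩ Set.Ico m (m + n)).ncard

/-- The supremum defining `windowMax` is an attained maximum. -/
theorem windowMax_isGreatest (S : Set ℕ) (n : ℕ) :
    IsGreatest (Set.range fun m : ℕ => (S ∩ Set.Ico m (m + n)).ncard) (windowMax S n) := by
  have hb : BddAbove (Set.range fun m : ℕ => (S ∩ Set.Ico m (m + n)).ncard) := by
    refine ⟨n, ?_⟩
    rintro _ ⟨m, rfl⟩
    have h : (S ∩ Set.Ico m (m + n)).ncard ≤ (Set.Ico m (m + n)).ncard :=
      Set.ncard_le_ncard Set.inter_subset_right (Set.finite_Ico m (m + n))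
    have h2 : (Set.Ico m (m + n)).ncard = n := by
      rw [← Finset.coe_Ico, Set.ncard_coe_finset, Nat.card_Ico]
      omega
    exact h.trans h2.le
  exact ⟨Nat.sSup_mem (Set.range_nonempty _) hb, fun x hx => le_csSup hb hx⟩

/-!
Work over an algebraic closure, and let `M` be divisible by a high power of `p` and by the orders of
all quotients of characteristic roots that are roots of unity. Along each progression `r + M + M ℕ`
the sequence is then a sum `∑ c β * β ^ m` over at most `d` nonzero `β`, no two of which have a root
of unity as quotient (`exists_sum_pow_on_progressions`). The power of `p` makes the multiple roots
disappear, because `X ^ (p ^ e) - x ^ (p ^ e) = (X - x) ^ (p ^ e)`. A zero at `m` says that the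
vector `α ^ m = (β ^ m)_β` lies in the hyperplane with coefficients `c`, and translating a window
only multiplies `c β` by a power of `β`. So it is enough to bound `#{n < N : α ^ n ∈ W}` uniformly
over all proper subspaces `W` of `K ^ ι` by `O((log N) ^ (dim W - 1))`; this is
`exists_powerCount_le`.

The bound is an induction on the dimension and on `log_p N`. Among the exponents `n = r + p m`, the
condition `α ^ n ∈ W` becomes `α ^ m ∈ W_r`, where `W_r` is the pullback of `W` under the
Frobenius-semilinear map `w ↦ α ^ r * w ^ p`, and `dim W_r ≤ dim W`. If equality holds for at most
one residue `r`, then the counts satisfy `f_k(p N) ≤ f_k(N) + (p - 1) f_{k-1}(N)`, which gives the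
logarithmic power. If equality holds for two residues `r` and `r + t`, then the twists of `W` by
`α ^ (-r)` and `α ^ (-(r + t))` are both spanned by vectors over the field of `p`-th powers; applying a
linear functional over that field coordinatewise gives a diagonal matrix preserving `W`
(`Submodule.exists_diagonal_mul_mem`). It is not scalar as soon as some quotient of the `α i` is not
a `p`-th power, so `W` splits along a partition of the coordinates, and an induction on the number
of coordinates applies. One may always extract `p`-th roots until such a quotient appears: in a
finitely generated field an element with `p ^ e`-th roots for all `e` is algebraic over the prime
field (`isAlgebraic_of_forall_exists_pow`), hence zero or a root of unity.
-/

/-! ### Infinitely `p`-divisible elements of finitely generated fields -/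

open Polynomial in
/-- Over `F[y ^ n]`, the powers `1, y, …, y ^ (n - 1)` of a transcendental `y` are independent, since
exponents of different terms of a relation differ modulo `n`. -/
theorem linearIndependent_pow_of_transcendental {F K : Type*} [Field F] [Field K] [Algebra F K]
    {y : K} (hy : Transcendental F y) {n : ℕ} (hn : 0 < n) :
    LinearIndependent (Algebra.adjoin F {y ^ n}) (fun j : Fin n => y ^ (j : ℕ)) := by
  rw [Fintype.linearIndependent_iff]
  intro g hg
  have hG : ∀ j, ∃ G : F[X], aeval (y ^ n) G = (g j : K) := by
    intro j
    have h := (g j).2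
    exact (Algebra.adjoin_singleton_eq_range_aeval F (y ^ n)).le h
  choose G hG using hG
  have hP : aeval y (∑ j : Fin n, expand F n (G j) * X ^ (j : ℕ)) = 0 := by
    rw [map_sum, ← hg]
    refine Finset.sum_congr rfl fun j _ => ?_
    rw [map_mul, expand_aeval, hG, map_pow, aeval_X, Algebra.smul_def]
    rfl
  have hP0 := (transcendental_iff.1 hy) _ hP
  have hG0 : ∀ j, G j = 0 := by
    intro j
    ext i
    have hc := congrArg (fun P => P.coeff (i * n + j)) hP0
    simp only [finsetSum_coeff, coeff_mul_X_pow', coeff_zero, coeff_expand hn] at hc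
    rw [Finset.sum_eq_single j] at hc
    · simpa [hn] using hc
    · intro l _ hl
      split_ifs with h1 h2
      · exfalso
        apply hl
        obtain ⟨c, hc⟩ := h2
        have h3 : (i * n + j) % n = (n * c + l) % n := by congr 1; omega
        rw [Nat.mul_add_mod_self_right, Nat.mul_add_mod_self_left, Nat.mod_eq_of_lt j.2,
          Nat.mod_eq_of_lt l.2] at h3
        exact Fin.ext h3.symm
      · rfl
      · rfl
    · simp
  intro j
  apply Subtype.ext
  rw [← hG, hG0]
  simp

open scoped IntermediateField.algebraAdjoinAdjoin in
/-- A root of order `p ^ e` of `x` would have degree `p ^ e` over `F(x)`, which exceeds `[K : F(x)]`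
for large `e`. -/
theorem not_forall_exists_pow_of_transcendental {F K : Type*} [Field F] [Field K] [Algebra F K]
    {x : K} (hx : Transcendental F x) [FiniteDimensional (IntermediateField.adjoin F {x}) K]
    {p : ℕ} (hp : 1 < p) : ¬ ∀ e : ℕ, ∃ y : K, y ^ p ^ e = x := by
  intro hroot
  obtain ⟨y, hy⟩ := hroot (Module.finrank (IntermediateField.adjoin F {x}) K + 1)
  generalize hm : Module.finrank (IntermediateField.adjoin F {x}) K = m at hy
  have hlt : m + 1 < p ^ (m + 1) := Nat.lt_pow_self hp
  have hyF : Transcendental F y := fun h => hx (hy ▸ h.pow _)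
  have h1 := linearIndependent_pow_of_transcendental hyF (n := p ^ (m + 1)) (by omega)
  rw [hy] at h1
  have h2 : LinearIndependent (IntermediateField.adjoin F {x})
      (fun j : Fin (p ^ (m + 1)) => y ^ (j : ℕ)) :=
    (LinearIndependent.iff_fractionRing (Algebra.adjoin F {x})
      (IntermediateField.adjoin F {x})).1 h1
  have h3 := h2.fintype_card_le_finrank
  simp only [Fintype.card_fin] at h3
  omega

open scoped IntermediateField.algebraAdjoinAdjoin in
/-- If `x` were transcendental, it would belong to a transcendence basis, and `K` would be finite
over `F(x)`, where `F` is generated by the other basis elements. -/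
theorem isAlgebraic_of_forall_exists_pow {k K : Type*} [Field k] [Field K] [Algebra k K]
    [Algebra.EssFiniteType k K] {p : ℕ} (hp : 1 < p) {x : K}
    (hx : ∀ e : ℕ, ∃ y : K, y ^ p ^ e = x) : IsAlgebraic k x := by
  by_contra htr
  have hind : AlgebraicIndepOn k id ({x} : Set K) :=
    algebraicIndependent_unique_type_iff.mpr htr
  obtain ⟨B, hxB, hB⟩ := exists_isTranscendenceBasis_superset hind
  have hxB' : insert x (B \ {x}) = B := by simpa using hxB
  have hxF : Transcendental (IntermediateField.adjoin k (B \ {x})) x := by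
    have h1 : AlgebraicIndepOn k id (insert x (B \ {x})) := by
      rw [hxB']
      exact hB.1
    have h2 := ((AlgebraicIndepOn.insert_iff (by simp)).1 h1).2
    rw [Set.image_id] at h2
    intro h3
    exact h2 ((IsFractionRing.isAlgebraic_iff (Algebra.adjoin k (B \ {x}))
      (IntermediateField.adjoin k (B \ {x})) K).2 h3)
  have h4 : Algebra.IsAlgebraic
      (IntermediateField.adjoin (IntermediateField.adjoin k (B \ {x})) {x}) K := by
    have h5 := hB.isAlgebraic_field
    rw [Subtype.range_coe] at h5
    refine ⟨fun z => ?_⟩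
    have h6 := h5.isAlgebraic z
    have h7 : IntermediateField.adjoin k B ≤ (IntermediateField.adjoin
        (IntermediateField.adjoin k (B \ {x})) {x}).restrictScalars k := by
      rw [IntermediateField.adjoin_adjoin_left, Set.union_singleton, hxB']
    have h8 := IsAlgebraic.tower_top_of_subalgebra_le
      (A := (IntermediateField.adjoin k B).toSubalgebra)
      (B := ((IntermediateField.adjoin
        (IntermediateField.adjoin k (B \ {x})) {x}).restrictScalars k).toSubalgebra) h7 h6
    exact h8
  have : Algebra.EssFiniteType (IntermediateField.adjoin k (B \ {x})) K :=
    Algebra.EssFiniteType.of_comp k _ K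
  have : Algebra.EssFiniteType
      (IntermediateField.adjoin (IntermediateField.adjoin k (B \ {x})) {x}) K :=
    Algebra.EssFiniteType.of_comp (IntermediateField.adjoin k (B \ {x})) _ K
  have hfin := Algebra.finite_of_essFiniteType_of_isAlgebraic
    (F := IntermediateField.adjoin (IntermediateField.adjoin k (B \ {x})) {x}) (E := K)
  exact not_forall_exists_pow_of_transcendental hxF hp hx

theorem isOfFinOrder_of_forall_exists_pow {K : Type*} [Field K] {p : ℕ} [Fact p.Prime]
    [Algebra (ZMod p) K] [Algebra.EssFiniteType (ZMod p) K] {x : K} (hx0 : x ≠ 0)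
    (hx : ∀ e : ℕ, ∃ y : K, y ^ p ^ e = x) : ∃ n, 0 < n ∧ x ^ n = 1 := by
  have halg := isAlgebraic_of_forall_exists_pow (k := ZMod p) (Fact.out : p.Prime).one_lt hx
  have : FiniteDimensional (ZMod p) (IntermediateField.adjoin (ZMod p) {x}) :=
    IntermediateField.adjoin.finiteDimensional halg.isIntegral
  have : Finite (IntermediateField.adjoin (ZMod p) {x}) := Module.finite_of_finite (ZMod p)
  let x' : (IntermediateField.adjoin (ZMod p) {x})ˣ :=
    Units.mk0 ⟨x, IntermediateField.mem_adjoin_simple_self _ x⟩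
      (by simpa [Subtype.ext_iff] using hx0)
  obtain ⟨n, hn, h⟩ := (isOfFinOrder_of_finite x').exists_pow_eq_one
  refine ⟨n, hn, ?_⟩
  have := congrArg (fun u : (IntermediateField.adjoin (ZMod p) {x})ˣ =>
    ((u : IntermediateField.adjoin (ZMod p) {x}) : K)) h
  simpa [x'] using this

/-! ### Semilinear pullbacks of subspaces -/

/-- Pullback of a subspace `W` of `K^ι` under the semilinear map `w ↦ β * σ(w)`, where the field
endomorphism `σ` acts on each coordinate and `β` is a diagonal matrix. It is again a subspace
over `K`, even when `σ` is not surjective. -/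
def Submodule.twistedComap {K ι : Type*} [Field K] (σ : K →+* K) (β : ι → K)
    (W : Submodule K (ι → K)) : Submodule K (ι → K) where
  carrier := {w | β * (σ ∘ w) ∈ W}
  zero_mem' := by
    have : β * (σ ∘ (0 : ι → K)) = 0 := by ext; simp
    rw [Set.mem_ofPred, this]
    exact W.zero_mem
  add_mem' {v w} hv hw := by
    have : β * (σ ∘ (v + w)) = β * (σ ∘ v) + β * (σ ∘ w) := by ext; simp [mul_add]
    rw [Set.mem_ofPred, this]
    exact W.add_mem hv hw
  smul_mem' c w hw := by
    have : β * (σ ∘ (c • w)) = σ c • (β * (σ ∘ w)) := by ext; simp [mul_left_comm]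
    rw [Set.mem_ofPred, this]
    exact W.smul_mem (σ c) hw

section Twist

variable {K ι : Type*} [Field K] {σ : K →+* K} {β γ : ι → K} {W : Submodule K (ι → K)}

theorem Submodule.mem_twistedComap {w : ι → K} :
    w ∈ W.twistedComap σ β ↔ β * (σ ∘ w) ∈ W := Iff.rfl

/-- The matrix of an independent family has a one-sided inverse, and `σ` maps it to an inverse of the
transformed matrix. -/
theorem LinearIndependent.comp_ringHom [Fintype ι] {κ : Type*} [Fintype κ] {b : κ → ι → K}
    (hb : LinearIndependent K b) (σ : K →+* K) : LinearIndependent K (fun j => σ ∘ b j) := by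
  classical
  let M : Matrix κ ι K := Matrix.of b
  have hM : Function.Injective M.vecMulLinear := Matrix.vecMul_injective_iff.2 hb
  obtain ⟨g, hg⟩ := LinearMap.exists_leftInverse_of_injective _ (LinearMap.ker_eq_bot.2 hM)
  let B : Matrix ι κ K := (LinearMap.toMatrix' g).transpose
  have hB : M * B = 1 := by
    have h1 : (B.transpose * M.transpose) = 1 := by
      rw [← LinearMap.toMatrix'_id, ← hg, LinearMap.toMatrix'_comp]
      congr 1
      ext i j
      simp [LinearMap.toMatrix'_apply, M]
    rw [← Matrix.transpose_mul] at h1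
    simpa using congrArg Matrix.transpose h1
  have hB' : M.map σ * B.map σ = 1 := by
    rw [← Matrix.map_mul, hB]
    simp
  refine Matrix.vecMul_injective_iff (M := M.map σ).1 fun v w hvw => ?_
  have h2 := congrArg (fun x => Matrix.vecMul x (B.map σ)) hvw
  simpa [Matrix.vecMul_vecMul, hB'] using h2

theorem LinearIndependent.twist [Fintype ι] {κ : Type*} [Fintype κ] {b : κ → ι → K}
    (hb : LinearIndependent K b) (σ : K →+* K) (hβ : ∀ i, β i ≠ 0) :
    LinearIndependent K (fun j => β * (σ ∘ b j)) := by
  refine (hb.comp_ringHom σ).map' (LinearMap.mulLeft K β) (LinearMap.ker_eq_bot.2 ?_)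
  intro v w hvw
  ext i
  exact mul_left_cancel₀ (hβ i) (congrFun hvw i)

theorem Submodule.finrank_twistedComap_le [Fintype ι] (σ : K →+* K) (hβ : ∀ i, β i ≠ 0)
    (W : Submodule K (ι → K)) :
    Module.finrank K (W.twistedComap σ β) ≤ Module.finrank K W := by
  let b := Module.finBasis K (W.twistedComap σ β)
  have hb : LinearIndependent K (fun j => (b j : ι → K)) :=
    b.linearIndependent.map' (Submodule.subtype _) (Submodule.ker_subtype _)
  have h1 := hb.twist σ hβ
  have h2 : LinearIndependent K (fun j => (⟨β * (σ ∘ (b j : ι → K)), (b j).2⟩ : W)) :=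
    LinearIndependent.of_comp W.subtype h1
  simpa using h2.fintype_card_le_finrank

/-- When the pullback has full dimension, `W` is a diagonal twist of a subspace defined over the image
of `σ`. -/
theorem Submodule.span_twist_eq_of_finrank_eq [Fintype ι] (hβ : ∀ i, β i ≠ 0)
    (h : Module.finrank K (W.twistedComap σ β) = Module.finrank K W) :
    Submodule.span K ((fun w : ι → K => β * (σ ∘ w)) '' (W.twistedComap σ β)) = W := by
  let b := Module.finBasis K (W.twistedComap σ β)
  have hb : LinearIndependent K (fun j => (b j : ι → K)) :=
    b.linearIndependent.map' (Submodule.subtype _) (Submodule.ker_subtype _)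
  have h1 := hb.twist σ hβ
  have h2 : Submodule.span K (Set.range fun j => β * (σ ∘ (b j : ι → K))) ≤
      Submodule.span K ((fun w : ι → K => β * (σ ∘ w)) '' (W.twistedComap σ β)) := by
    refine Submodule.span_mono ?_
    rintro _ ⟨j, rfl⟩
    exact ⟨_, (b j).2, rfl⟩
  have h3 : Submodule.span K ((fun w : ι → K => β * (σ ∘ w)) '' (W.twistedComap σ β)) ≤ W := by
    rw [Submodule.span_le]
    rintro _ ⟨w, hw, rfl⟩
    exact hw
  refine Submodule.eq_of_le_of_finrank_le h3 ?_
  have h4 := finrank_span_eq_card h1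
  rw [Fintype.card_fin] at h4
  rw [← h, ← h4]
  exact Submodule.finrank_mono h2

theorem Submodule.twistedComap_ne_top [Fintype ι] (hβ : ∀ i, β i ≠ 0)
    (hW : W ≠ ⊤) : W.twistedComap σ β ≠ ⊤ := by
  intro h
  apply hW
  refine Submodule.eq_top_of_finrank_eq (le_antisymm (Submodule.finrank_le _) ?_)
  have := Submodule.finrank_twistedComap_le σ hβ W
  rwa [h, finrank_top] at this

/-- If `W` is, up to the twists `β` and `β * γ`, defined over the image of `σ` in two ways, then it is
preserved by a diagonal matrix, which is not scalar when a quotient of two entries of `γ` is not in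
the image of `σ`. -/
theorem Submodule.exists_diagonal_mul_mem [Fintype ι] (hβ : ∀ i, β i ≠ 0) (hγ : ∀ i, γ i ≠ 0)
    (h1 : Module.finrank K (W.twistedComap σ β) = Module.finrank K W)
    (h2 : Module.finrank K (W.twistedComap σ (β * γ)) = Module.finrank K W)
    {i j : ι} (hi : γ i = 1) (hj : γ j ∉ σ.fieldRange) :
    ∃ δ : ι → K, δ i ≠ δ j ∧ ∀ w ∈ W, δ * w ∈ W := by
  -- `φ` is a functional over the image of `σ` which kills `1 = γ i` but not `γ j`.
  obtain ⟨φ, hφj, hφ⟩ := Submodule.exists_dual_map_eq_bot_of_notMem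
    (R := σ.fieldRange) (M := K) (p := Submodule.span σ.fieldRange {1}) (x := γ j) (by
      intro h
      obtain ⟨c, hc⟩ := Submodule.mem_span_singleton.1 h
      apply hj
      rw [← hc, Subfield.smul_def, smul_eq_mul, mul_one]
      exact c.2) inferInstance
  have hφ1 : φ 1 = 0 := by
    have : φ 1 ∈ (Submodule.span σ.fieldRange {(1 : K)}).map φ :=
      Submodule.mem_map_of_mem (Submodule.mem_span_singleton_self 1)
    rwa [hφ, Submodule.mem_bot] at this
  have hφσ : ∀ c x : K, (φ (c * σ x) : K) = φ c * σ x := by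
    intro c x
    have : c * σ x = (⟨σ x, ⟨x, rfl⟩⟩ : σ.fieldRange) • c := by
      rw [Subfield.smul_def, smul_eq_mul, mul_comm]
    rw [this, map_smul, smul_eq_mul, Subfield.coe_mul, mul_comm]
  -- `W` twisted by `β⁻¹` is spanned over the image of `σ`, so it is stable under coordinatewise `φ`.
  have key : ∀ w ∈ W, ∀ c : K, (fun k => β k * (φ (c * (w k / β k)) : K)) ∈ W := by
    intro w hw
    rw [← Submodule.span_twist_eq_of_finrank_eq hβ h1] at hw
    induction hw using Submodule.span_induction with
    | mem x hx =>
      obtain ⟨v, hv, rfl⟩ := hx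
      intro c
      have : (fun k => β k * (φ (c * ((β * (σ ∘ v)) k / β k)) : K)) =
          (φ c : K) • (β * (σ ∘ v)) := by
        ext k
        rw [Pi.mul_apply, mul_div_cancel_left₀ _ (hβ k), Function.comp_apply, hφσ]
        simp [mul_left_comm]
      rw [this]
      exact W.smul_mem _ hv
    | zero =>
      intro c
      convert W.zero_mem using 1
      ext k
      simp
    | add x y _ _ hx hy =>
      intro c
      have := W.add_mem (hx c) (hy c)
      convert this using 1
      ext k
      simp [add_div, mul_add]
    | smul a x _ hx =>
      intro c
      convert hx (c * a) using 4
      simp [mul_div_assoc, mul_assoc]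
  refine ⟨fun k => φ (γ k) / γ k, ?_, ?_⟩
  · simp only [hi, hφ1]
    intro h
    have h3 : (φ (γ j) : K) = 0 := by simpa [hγ j] using h.symm
    exact hφj (Subtype.ext h3)
  · intro w hw
    rw [← Submodule.span_twist_eq_of_finrank_eq (β := β * γ)
      (fun k => mul_ne_zero (hβ k) (hγ k)) h2] at hw
    induction hw using Submodule.span_induction with
    | mem x hx =>
      obtain ⟨v, hv, rfl⟩ := hx
      convert key _ hv 1 using 1
      ext k
      have h3 : ((β * γ) * (σ ∘ v)) k / β k = γ k * σ (v k) := by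
        rw [Pi.mul_apply, Pi.mul_apply, mul_assoc, mul_div_cancel_left₀ _ (hβ k),
          Function.comp_apply]
      rw [h3, one_mul, hφσ]
      simp only [Pi.mul_apply, Function.comp_apply]
      field_simp [hγ k]
    | zero => simp
    | add x y _ _ hx hy => rw [mul_add]; exact W.add_mem hx hy
    | smul a x _ hx => rw [mul_smul_comm]; exact W.smul_mem a hx

open Polynomial in
/-- The projection to the coordinates in a level set of `δ` is a polynomial in the diagonal matrix
`δ`. -/
theorem Submodule.exists_indicator_mul_mem [Fintype ι] {δ : ι → K}
    (hδ : ∀ w ∈ W, δ * w ∈ W) (i : ι) :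
    ∀ w ∈ W, (Set.indicator {k | δ k = δ i} 1 : ι → K) * w ∈ W := by
  classical
  have hpow : ∀ P : K[X], ∀ w ∈ W, (fun k => P.eval (δ k)) * w ∈ W := by
    intro P
    induction P using Polynomial.induction_on' with
    | add P Q hP hQ =>
      intro w hw
      convert W.add_mem (hP w hw) (hQ w hw) using 1
      ext k
      simp [add_mul]
    | monomial n a =>
      induction n generalizing a with
      | zero =>
        intro w hw
        convert W.smul_mem a hw using 1
        ext k
        simp
      | succ n ih =>
        intro w hw
        convert hδ _ (ih a w hw) using 1
        ext k
        simp
        ring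
  intro w hw
  convert hpow (Lagrange.basis (Finset.univ.image δ) id (δ i)) w hw using 2
  ext k
  by_cases h : δ k = δ i
  · have := Lagrange.eval_basis_self (s := Finset.univ.image δ) (v := id) (i := δ i)
      Function.injective_id.injOn (by simp)
    simp only [id] at this
    simp [h, this]
  · have := Lagrange.eval_basis_of_ne (s := Finset.univ.image δ) (v := id) (i := δ i) (j := δ k)
      (Ne.symm h) (by simp)
    simp only [id] at this
    simp [h, this]

theorem Submodule.map_funLeft_ne_top_or [Finite ι] {s : Set ι}
    (hs : ∀ w ∈ W, (s.indicator 1 : ι → K) * w ∈ W) (hW : W ≠ ⊤) :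
    W.map (LinearMap.funLeft K K ((↑) : s → ι)) ≠ ⊤ ∨
      W.map (LinearMap.funLeft K K ((↑) : (sᶜ : Set ι) → ι)) ≠ ⊤ := by
  by_contra! h
  apply hW
  rw [eq_top_iff]
  intro x _
  obtain ⟨v, hv, hvx⟩ : (LinearMap.funLeft K K ((↑) : s → ι) x) ∈
    W.map (LinearMap.funLeft K K ((↑) : s → ι)) := by rw [h.1]; trivial
  obtain ⟨w, hw, hwx⟩ : (LinearMap.funLeft K K ((↑) : (sᶜ : Set ι) → ι) x) ∈
    W.map (LinearMap.funLeft K K ((↑) : (sᶜ : Set ι) → ι)) := by rw [h.2]; trivial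
  have : x = (s.indicator 1 : ι → K) * v + (w - (s.indicator 1 : ι → K) * w) := by
    ext k
    by_cases hk : k ∈ s
    · have := congrFun hvx ⟨k, hk⟩
      simp only [LinearMap.funLeft_apply] at this
      simp [hk, this]
    · have := congrFun hwx ⟨k, hk⟩
      simp only [LinearMap.funLeft_apply] at this
      simp [hk, this]
  rw [this]
  exact W.add_mem (hs v hv) (W.sub_mem hw (hs w hw))

end Twist

theorem mem_of_pow_mem_of_coprime {K : Type*} [Field K] {L : Subfield K} {x : K} {p t : ℕ}
    (hx : x ≠ 0) (hp : x ^ p ∈ L) (ht : x ^ t ∈ L) (h : Nat.Coprime t p) : x ∈ L := by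
  have h1 : x = (x ^ t) ^ (Nat.gcdA t p) * (x ^ p) ^ (Nat.gcdB t p) := by
    have h2 := Nat.gcd_eq_gcd_ab t p
    rw [h.gcd_eq_one] at h2
    rw [← zpow_natCast, ← zpow_natCast, ← zpow_mul, ← zpow_mul, ← zpow_add₀ hx, ← h2]
    simp
  rw [h1]
  exact L.mul_mem (zpow_mem ht _) (zpow_mem hp _)

/-! ### Counting powers of a vector in a subspace -/

section Count

variable {K ι : Type*} [Field K]

open Classical in
/-- The number of `n < N` for which the vector `(α i ^ n)ᵢ` lies in `W`. -/
noncomputable def powerCount (α : ι → K) (W : Submodule K (ι → K)) (N : ℕ) : ℕ :=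
  ((Finset.range N).filter fun n => α ^ n ∈ W).card

theorem powerCount_le (α : ι → K) (W : Submodule K (ι → K)) (N : ℕ) : powerCount α W N ≤ N := by
  classical
  exact (Finset.card_filter_le _ _).trans_eq (Finset.card_range N)

theorem powerCount_le_powerCount {κ : Type*} {α : ι → K} {W : Submodule K (ι → K)} {β : κ → K}
    {V : Submodule K (κ → K)} (h : ∀ n, α ^ n ∈ W → β ^ n ∈ V) (N : ℕ) :
    powerCount α W N ≤ powerCount β V N := by
  classical
  exact Finset.card_le_card (Finset.monotone_filter_right _ fun n _ hn => h n hn)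

/-- Two distinct powers of `α` are never proportional. -/
theorem powerCount_le_one {α : ι → K} (hα : ∀ i, α i ≠ 0)
    (htor : ∀ i j, i ≠ j → ∀ n, 0 < n → α i ^ n ≠ α j ^ n) [Fintype ι] [Nontrivial ι]
    {W : Submodule K (ι → K)} (hW : Module.finrank K W ≤ 1) (N : ℕ) : powerCount α W N ≤ 1 := by
  classical
  obtain ⟨i, j, hij⟩ := exists_pair_ne ι
  obtain ⟨w, hw⟩ := finrank_le_one_iff.1 hW
  have key : ∀ m n, m < n → α ^ m ∈ W → α ^ n ∈ W → False := by
    intro m n hmn hm hn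
    obtain ⟨a, ha⟩ := hw ⟨_, hm⟩
    obtain ⟨b, hb⟩ := hw ⟨_, hn⟩
    have ha' : ∀ k, a * (w : ι → K) k = α k ^ m := fun k =>
      congrFun (congrArg Subtype.val ha) k
    have hb' : ∀ k, b * (w : ι → K) k = α k ^ n := fun k =>
      congrFun (congrArg Subtype.val hb) k
    apply htor i j hij (n - m) (by omega)
    have ha0 : a ≠ 0 := by
      intro h
      have := ha' i
      rw [h, zero_mul] at this
      exact pow_ne_zero m (hα i) this.symm
    have h1 : ∀ k, α k ^ (n - m) = b / a := by
      intro k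
      rw [pow_sub₀ _ (hα k) hmn.le, ← ha', ← hb']
      have : (w : ι → K) k ≠ 0 := by
        intro h
        have := ha' k
        rw [h, mul_zero] at this
        exact pow_ne_zero m (hα k) this.symm
      field_simp
    rw [h1, h1]
  refine Finset.card_le_one.2 fun m hm n hn => ?_
  rw [Finset.mem_filter] at hm hn
  rcases lt_trichotomy m n with h | h | h
  · exact (key m n h hm.2 hn.2).elim
  · exact h
  · exact (key n m h hn.2 hm.2).elim

theorem powerCount_eq_zero_of_subsingleton [Subsingleton ι] {α : ι → K} (hα : ∀ i, α i ≠ 0)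
    {W : Submodule K (ι → K)} (hW : W ≠ ⊤) (N : ℕ) : powerCount α W N = 0 := by
  classical
  refine Finset.card_eq_zero.2 (Finset.filter_eq_empty_iff.2 fun n _ hn => hW ?_)
  rw [eq_top_iff]
  intro x _
  rcases isEmpty_or_nonempty ι with h | ⟨⟨i⟩⟩
  · convert W.zero_mem
  · have : x = (x i / α i ^ n) • α ^ n := by
      ext j
      rw [Subsingleton.elim j i]
      simp [hα i]
    rw [this]
    exact W.smul_mem _ hn

/-- Sorting the exponents by their residue modulo `p` turns the count for `W` into counts for the
Frobenius pullbacks of `W`. -/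
theorem powerCount_mul_le_sum {p : ℕ} [Fact p.Prime] [CharP K p] (α : ι → K)
    (W : Submodule K (ι → K)) (N : ℕ) :
    powerCount α W (p * N) ≤
      ∑ r ∈ Finset.range p, powerCount α (W.twistedComap (frobenius K p) (α ^ r)) N := by
  classical
  have hp : 0 < p := (Fact.out : p.Prime).pos
  have hsub : ((Finset.range (p * N)).filter fun n => α ^ n ∈ W) ⊆
      (Finset.range p).biUnion fun r =>
        ((Finset.range N).filter fun n =>
          α ^ n ∈ W.twistedComap (frobenius K p) (α ^ r)).image fun m => r + p * m := by
    intro n hn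
    rw [Finset.mem_filter, Finset.mem_range] at hn
    simp only [Finset.mem_biUnion, Finset.mem_image, Finset.mem_filter, Finset.mem_range]
    refine ⟨n % p, Nat.mod_lt _ hp, n / p, ⟨Nat.div_lt_of_lt_mul hn.1, ?_⟩, Nat.mod_add_div n p⟩
    rw [Submodule.mem_twistedComap]
    convert hn.2 using 1
    ext i
    simp only [Pi.mul_apply, Pi.pow_apply, Function.comp_apply, frobenius_def]
    rw [← pow_mul, ← pow_add, mul_comm (n / p), Nat.mod_add_div]
  refine (Finset.card_le_card hsub).trans (Finset.card_biUnion_le.trans ?_)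
  exact Finset.sum_le_sum fun r _ => Finset.card_image_le

/-- If the pullbacks of `W` for two residues both have full dimension, then `W` splits along a
partition of the coordinates, and the count for `W` is bounded by one on fewer coordinates. -/
theorem powerCount_le_of_finrank_twistedComap_eq [Fintype ι] {p : ℕ} [Fact p.Prime] [CharP K p]
    {α : ι → K} (hα : ∀ i, α i ≠ 0) {i j : ι} (hi : α i = 1)
    (hj : α j ∉ (frobenius K p).fieldRange) {W : Submodule K (ι → K)} (hW : W ≠ ⊤)
    {r t : ℕ} (ht : 0 < t) (htp : t < p)
    (h1 : Module.finrank K (W.twistedComap (frobenius K p) (α ^ r)) = Module.finrank K W)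
    (h2 : Module.finrank K (W.twistedComap (frobenius K p) (α ^ (r + t))) = Module.finrank K W) :
    ∃ s : Set ι, s ≠ Set.univ ∧ ∃ V : Submodule K (s → K), V ≠ ⊤ ∧
      Module.finrank K V ≤ Module.finrank K W ∧
      ∀ N, powerCount α W N ≤ powerCount (fun k : s => α k) V N := by
  have hcop : Nat.Coprime t p :=
    Nat.Coprime.symm ((Nat.Prime.coprime_iff_not_dvd Fact.out).2 (Nat.not_dvd_of_pos_of_lt ht htp))
  have hj' : (α ^ t) j ∉ (frobenius K p).fieldRange := fun h =>
    hj (mem_of_pow_mem_of_coprime (hα j) ⟨α j, rfl⟩ h hcop)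
  rw [pow_add] at h2
  obtain ⟨δ, hδ, hδW⟩ := Submodule.exists_diagonal_mul_mem (β := α ^ r) (γ := α ^ t)
    (fun k => pow_ne_zero _ (hα k)) (fun k => pow_ne_zero _ (hα k)) h1 h2 (i := i) (by simp [hi]) hj'
  have hind := Submodule.exists_indicator_mul_mem hδW i
  have main : ∀ s : Set ι, W.map (LinearMap.funLeft K K ((↑) : s → ι)) ≠ ⊤ → s ≠ Set.univ →
      ∃ s : Set ι, s ≠ Set.univ ∧ ∃ V : Submodule K (s → K), V ≠ ⊤ ∧
      Module.finrank K V ≤ Module.finrank K W ∧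
      ∀ N, powerCount α W N ≤ powerCount (fun k : s => α k) V N := by
    intro s hs hsu
    refine ⟨s, hsu, _, hs, Submodule.finrank_map_le _ _, powerCount_le_powerCount fun n hn => ?_⟩
    exact ⟨α ^ n, hn, rfl⟩
  rcases Submodule.map_funLeft_ne_top_or hind hW with h | h
  · refine main _ h fun h' => ?_
    have : j ∈ {k | δ k = δ i} := by rw [h']; trivial
    exact hδ this.symm
  · refine main _ h fun h' => ?_
    have : i ∈ {k | δ k = δ i}ᶜ := by rw [h']; trivial
    exact this rfl

/-- The induction on `N` for a vector with one coordinate equal to `1` and another one that is not a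
`p`-th power: `C₁` is a constant for subspaces of smaller dimension, `C₂` one for fewer
coordinates. -/
theorem powerCount_pow_le [Fintype ι] {p : ℕ} [Fact p.Prime] [CharP K p]
    {α : ι → K} (hα : ∀ i, α i ≠ 0) {i j : ι} (hi : α i = 1)
    (hj : α j ∉ (frobenius K p).fieldRange) {k C₁ C₂ : ℕ}
    (h₁ : ∀ W : Submodule K (ι → K), W ≠ ⊤ → Module.finrank K W ≤ k + 1 →
      ∀ N, powerCount α W (p ^ N) ≤ C₁ * (N + 1) ^ k)
    (h₂ : ∀ s : Set ι, s ≠ Set.univ → ∀ V : Submodule K (s → K), V ≠ ⊤ →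
      Module.finrank K V ≤ k + 2 →
      ∀ N, powerCount (fun l : s => α l) V (p ^ N) ≤ C₂ * (N + 1) ^ (k + 1)) (N : ℕ) :
    ∀ W : Submodule K (ι → K), W ≠ ⊤ → Module.finrank K W ≤ k + 2 →
      powerCount α W (p ^ N) ≤ (1 + p * C₁ + C₂) * (N + 1) ^ (k + 1) := by
  induction N with
  | zero =>
    intro W _ _
    refine (powerCount_le _ _ _).trans ?_
    simp
    omega
  | succ N ih =>
    intro W hW hWk
    by_cases hgood : ∃ r t, 0 < t ∧ t < p ∧
      Module.finrank K (W.twistedComap (frobenius K p) (α ^ r)) = Module.finrank K W ∧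
      Module.finrank K (W.twistedComap (frobenius K p) (α ^ (r + t))) = Module.finrank K W
    · obtain ⟨r, t, ht, htp, e1, e2⟩ := hgood
      obtain ⟨s, hs, V, hV, hVW, hc⟩ :=
        powerCount_le_of_finrank_twistedComap_eq hα hi hj hW ht htp e1 e2
      refine (hc _).trans ((h₂ s hs V hV (hVW.trans hWk) _).trans ?_)
      exact Nat.mul_le_mul_right _ (by omega)
    · have hα' : ∀ r l, (α ^ r) l ≠ 0 := fun r l => pow_ne_zero r (hα l)
      -- Only the residue `r₀` may keep the full dimension; all others lose at least one.
      have hsum : ∃ r₀, ∀ r ∈ Finset.range p,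
          powerCount α (W.twistedComap (frobenius K p) (α ^ r)) (p ^ N) ≤
          (if r = r₀ then (1 + p * C₁ + C₂) * (N + 1) ^ (k + 1) else 0) + C₁ * (N + 1) ^ k := by
        have hlt : ∀ r, Module.finrank K (W.twistedComap (frobenius K p) (α ^ r)) ≠
            Module.finrank K W →
            powerCount α (W.twistedComap (frobenius K p) (α ^ r)) (p ^ N) ≤
              C₁ * (N + 1) ^ k := by
          intro r hr
          refine h₁ _ (Submodule.twistedComap_ne_top (hα' r) hW) ?_ N
          have := Submodule.finrank_twistedComap_le (frobenius K p) (hα' r) W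
          omega
        by_cases hex : ∃ r₀ < p, Module.finrank K (W.twistedComap (frobenius K p) (α ^ r₀)) =
            Module.finrank K W
        · obtain ⟨r₀, hr₀p, hr₀⟩ := hex
          refine ⟨r₀, fun r hr => ?_⟩
          rw [Finset.mem_range] at hr
          split_ifs with h
          · refine le_add_right (ih _ (Submodule.twistedComap_ne_top (hα' r) hW) ?_)
            exact (Submodule.finrank_twistedComap_le (frobenius K p) (hα' r) W).trans hWk
          · rw [zero_add]
            refine hlt r fun hr' => hgood ?_
            rcases lt_or_gt_of_ne h with h | h
            · exact ⟨r, r₀ - r, by omega, by omega, hr', by rwa [Nat.add_sub_cancel' h.le]⟩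
            · exact ⟨r₀, r - r₀, by omega, by omega, hr₀, by rwa [Nat.add_sub_cancel' h.le]⟩
        · push Not at hex
          exact ⟨0, fun r hr => le_add_left (hlt r (hex r (Finset.mem_range.1 hr)))⟩
      obtain ⟨r₀, hr₀⟩ := hsum
      have h3 : ∑ r ∈ Finset.range p, ((if r = r₀ then (1 + p * C₁ + C₂) * (N + 1) ^ (k + 1) else 0)
          + C₁ * (N + 1) ^ k) ≤
          (1 + p * C₁ + C₂) * (N + 1) ^ (k + 1) + p * (C₁ * (N + 1) ^ k) := by
        rw [Finset.sum_add_distrib, Finset.sum_const, Finset.card_range, smul_eq_mul,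
          Finset.sum_ite_eq']
        gcongr
        split_ifs <;> simp
      rw [pow_succ']
      refine (powerCount_mul_le_sum α W _).trans ((Finset.sum_le_sum hr₀).trans (h3.trans ?_))
      have h4 : (N + 1) ^ (k + 1) + (N + 1) ^ k ≤ (N + 1 + 1) ^ (k + 1) := by
        calc (N + 1) ^ (k + 1) + (N + 1) ^ k = (N + 1) ^ k * (N + 1 + 1) := by ring
          _ ≤ (N + 1 + 1) ^ k * (N + 1 + 1) := by gcongr; omega
          _ = _ := by ring
      calc (1 + p * C₁ + C₂) * (N + 1) ^ (k + 1) + p * (C₁ * (N + 1) ^ k)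
          ≤ (1 + p * C₁ + C₂) * (N + 1) ^ (k + 1) + (1 + p * C₁ + C₂) * (N + 1) ^ k := by
            rw [← mul_assoc]
            gcongr
            omega
        _ = (1 + p * C₁ + C₂) * ((N + 1) ^ (k + 1) + (N + 1) ^ k) := by ring
        _ ≤ _ := by gcongr

end Count

/-- Dividing by one coordinate and extracting as many `p`-th roots as possible. -/
theorem exists_normalized_powers {K ι : Type*} [Field K] [Fintype ι] [Nontrivial ι]
    {p : ℕ} [Fact p.Prime] [CharP K p]
    (hK : ∀ x : K, x ≠ 0 → (∀ e : ℕ, ∃ y : K, y ^ p ^ e = x) → ∃ n, 0 < n ∧ x ^ n = 1)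
    {α : ι → K} (hα : ∀ i, α i ≠ 0)
    (htor : ∀ i j, i ≠ j → ∀ n, 0 < n → α i ^ n ≠ α j ^ n) :
    ∃ (u : ι → K) (c : K) (e : ℕ), c ≠ 0 ∧ (∀ i, α i = c * u i ^ p ^ e) ∧
      ∃ i j, u i = 1 ∧ u j ∉ (frobenius K p).fieldRange := by
  classical
  obtain ⟨i, j, hij⟩ := exists_pair_ne ι
  -- Not all quotients `α l / α i` have roots of every order `p ^ e`: extract roots up to the
  -- last `e` for which they all do.
  have hex : ∃ e : ℕ, ∃ l, ¬ ∃ y : K, y ^ p ^ e = α l / α i := by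
    by_contra! h
    obtain ⟨n, hn, h1⟩ := hK (α j / α i) (div_ne_zero (hα j) (hα i)) fun e => h e j
    rw [div_pow, div_eq_one_iff_eq (pow_ne_zero _ (hα i))] at h1
    exact htor i j hij n hn h1.symm
  have hspec := Nat.find_spec hex
  have hmin : ∀ e < Nat.find hex, ∀ l, ∃ y : K, y ^ p ^ e = α l / α i := by
    intro e he
    have := Nat.find_min hex he
    push Not at this
    exact this
  obtain ⟨l, hl⟩ := hspec
  obtain ⟨e, he⟩ : ∃ e, Nat.find hex = e + 1 := by
    refine Nat.exists_eq_succ_of_ne_zero fun h0 => hl ?_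
    rw [h0]
    exact ⟨_, by rw [pow_zero, pow_one]⟩
  rw [he] at hl
  choose u hu using hmin e (by omega)
  refine ⟨u, α i, e, hα i, fun m => ?_, i, l, ?_, ?_⟩
  · rw [hu, mul_div_cancel₀ _ (hα i)]
  · have h1 := hu i
    rw [div_self (hα i)] at h1
    apply iterateFrobenius_inj K p e
    rw [iterateFrobenius_def, h1, map_one]
  · rintro ⟨y, hy⟩
    apply hl
    refine ⟨y, ?_⟩
    rw [← hu, ← hy, frobenius_def, ← pow_mul, pow_succ']

/-- The constant depends on `α` and the dimension only, not on the subspace. -/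
theorem exists_powerCount_le {K : Type*} [Field K] {p : ℕ} [Fact p.Prime] [CharP K p]
    (hK : ∀ x : K, x ≠ 0 → (∀ e : ℕ, ∃ y : K, y ^ p ^ e = x) → ∃ n, 0 < n ∧ x ^ n = 1)
    (k : ℕ) (c : ℕ) {ι : Type*} [Fintype ι] (hc : Fintype.card ι = c) {α : ι → K}
    (hα : ∀ i, α i ≠ 0) (htor : ∀ i j, i ≠ j → ∀ n, 0 < n → α i ^ n ≠ α j ^ n) :
    ∃ C : ℕ, ∀ W : Submodule K (ι → K), W ≠ ⊤ → Module.finrank K W ≤ k + 1 →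
      ∀ N, powerCount α W (p ^ N) ≤ C * (N + 1) ^ k := by
  classical
  induction k generalizing ι c with
  | zero =>
    refine ⟨1, fun W hW hWk N => ?_⟩
    rw [pow_zero, mul_one]
    rcases subsingleton_or_nontrivial ι with h | h
    · rw [powerCount_eq_zero_of_subsingleton hα hW]
      exact zero_le_one
    · exact powerCount_le_one hα htor hWk _
  | succ k ihk =>
    induction c using Nat.strong_induction_on generalizing ι with
    | _ c ihc =>
    rcases subsingleton_or_nontrivial ι with h | h
    · refine ⟨0, fun W hW hWk N => ?_⟩
      rw [powerCount_eq_zero_of_subsingleton hα hW]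
      exact Nat.zero_le _
    obtain ⟨u, a, e, ha, hu, i, j, hi, hj⟩ := exists_normalized_powers hK hα htor
    have hu0 : ∀ l, u l ≠ 0 := by
      intro l hl
      apply hα l
      rw [hu, hl, zero_pow (pow_ne_zero _ (Fact.out : p.Prime).ne_zero), mul_zero]
    have hutor : ∀ l m, l ≠ m → ∀ n, 0 < n → u l ^ n ≠ u m ^ n := by
      intro l m hlm n hn h
      apply htor l m hlm n hn
      rw [hu, hu, mul_pow, mul_pow, ← pow_mul, ← pow_mul, mul_comm _ n, pow_mul, pow_mul, h]
    obtain ⟨C₁, hC₁⟩ := ihk c hc hu0 hutor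
    have hsets : ∀ s : Set ι, ∃ C : ℕ, s ≠ Set.univ → ∀ V : Submodule K (s → K), V ≠ ⊤ →
        Module.finrank K V ≤ k + 2 →
        ∀ N, powerCount (fun l : s => u l) V (p ^ N) ≤ C * (N + 1) ^ (k + 1) := by
      intro s
      by_cases hs : s = Set.univ
      · exact ⟨0, fun h => (h hs).elim⟩
      · have hlt : Fintype.card s < c := by
          obtain ⟨x, hx⟩ := (Set.ne_univ_iff_exists_notMem s).1 hs
          rw [← hc]
          exact Fintype.card_subtype_lt (p := (· ∈ s)) hx
        obtain ⟨C, hC⟩ := ihc _ hlt rfl (α := fun l : s => u l) (fun l => hu0 l)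
          (fun l m hlm => hutor l m (fun h => hlm (Subtype.ext h)))
        exact ⟨C, fun _ => hC⟩
    choose D hD using hsets
    refine ⟨1 + p * C₁ + ∑ s, D s, fun W hW hWk N => ?_⟩
    have hWu : powerCount α W (p ^ N) ≤
        powerCount u (W.twistedComap (iterateFrobenius K p e) 1) (p ^ N) := by
      refine powerCount_le_powerCount (fun n hn => ?_) _
      rw [Submodule.mem_twistedComap]
      convert W.smul_mem (a ^ n)⁻¹ hn using 1
      ext l
      simp only [Pi.mul_apply, Pi.one_apply, one_mul, Function.comp_apply, Pi.pow_apply,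
        iterateFrobenius_def, Pi.smul_apply, smul_eq_mul, hu l, mul_pow]
      rw [inv_mul_cancel_left₀ (pow_ne_zero n ha), ← pow_mul, ← pow_mul, mul_comm n]
    refine hWu.trans (powerCount_pow_le hu0 hi hj hC₁ (fun s hs V hV hVk M => ?_) N _
      (Submodule.twistedComap_ne_top (by simp) hW)
      ((Submodule.finrank_twistedComap_le _ (by simp) W).trans hWk))
    refine (hD s hs V hV hVk M).trans (Nat.mul_le_mul_right _ ?_)
    exact Finset.single_le_sum (f := D) (fun _ _ => Nat.zero_le _) (Finset.mem_univ s)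

/-! ### Restricting a recurrence sequence to progressions -/

section Reduction

open Polynomial

/-- The linear functional on polynomials with `X ^ n ↦ a n`. -/
noncomputable def seqFunctional {L : Type*} [Field L] (a : ℕ → L) : L[X] →ₗ[L] L :=
  (Polynomial.basisMonomials L).constr L a

theorem seqFunctional_X_pow {L : Type*} [Field L] (a : ℕ → L) (n : ℕ) :
    seqFunctional a (X ^ n) = a n := by
  have h := (Polynomial.basisMonomials L).constr_basis L a n
  simpa only [seqFunctional, Polynomial.coe_basisMonomials, ← X_pow_eq_monomial] using h

theorem seqFunctional_eq_zero_of_dvd {L : Type*} [Field L] {E : LinearRecurrence L} {a : ℕ → L}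
    (ha : E.IsSolution a) {P : L[X]} (hP : E.charPoly ∣ P) : seqFunctional a P = 0 := by
  obtain ⟨Q, rfl⟩ := hP
  induction Q using Polynomial.induction_on' with
  | add P Q hP hQ => rw [mul_add, map_add, hP, hQ, add_zero]
  | monomial n c =>
    have h1 : E.charPoly * monomial n c =
        c • (X ^ (n + E.order) - ∑ i, E.coeffs i • X ^ (n + (i : ℕ))) := by
      rw [LinearRecurrence.charPoly, ← C_mul_X_pow_eq_monomial, smul_eq_C_mul]
      simp only [← C_mul_X_pow_eq_monomial, map_one, one_mul, smul_eq_C_mul, pow_add, sub_mul,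
        Finset.sum_mul, mul_sub, Finset.mul_sum]
      congr 1
      · ring
      · exact Finset.sum_congr rfl fun i _ => by ring
    rw [h1, map_smul, map_sub, map_sum, seqFunctional_X_pow, ha n]
    simp [seqFunctional_X_pow]

theorem Lagrange.prod_X_sub_C_dvd_X_pow_sub {L : Type*} [Field L] [DecidableEq L] (B : Finset L)
    (m : ℕ) : (∏ β ∈ B, (X - C β)) ∣ X ^ m - ∑ β ∈ B, C (β ^ m) * Lagrange.basis B id β := by
  refine Finset.prod_dvd_of_coprime
    ((pairwise_coprime_X_sub_C Function.injective_id).set_pairwise _) fun β hβ => ?_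
  rw [dvd_iff_isRoot, IsRoot, eval_sub, eval_finsetSum, Finset.sum_eq_single β]
  · have := Lagrange.eval_basis_self (s := B) (v := id) (i := β) Function.injective_id.injOn hβ
    simp only [id] at this
    simp [this]
  · intro b _ hb
    have := Lagrange.eval_basis_of_ne (s := B) (v := id) (i := b) (j := β) hb hβ
    simp only [id] at this
    simp [this]
  · intro h
    exact (h hβ).elim

theorem exists_common_torsion_exponent {L : Type*} [Field L] (R : Finset L) :
    ∃ T : ℕ, 0 < T ∧ ∀ x ∈ R, ∀ y ∈ R, ∀ n, 0 < n → x ^ n = y ^ n → x ^ T = y ^ T := by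
  classical
  have h : ∀ q : L × L, ∃ n, 0 < n ∧ ((∃ m, 0 < m ∧ q.1 ^ m = q.2 ^ m) → q.1 ^ n = q.2 ^ n) := by
    intro q
    by_cases hq : ∃ m, 0 < m ∧ q.1 ^ m = q.2 ^ m
    · obtain ⟨m, hm, h⟩ := hq
      exact ⟨m, hm, fun _ => h⟩
    · exact ⟨1, one_pos, fun h => (hq h).elim⟩
  choose N hN0 hN using h
  refine ⟨∏ q ∈ R ×ˢ R, N q, Finset.prod_pos fun q _ => hN0 q, fun x hx y hy n hn hxy => ?_⟩
  obtain ⟨c, hc⟩ := Finset.dvd_prod_of_mem N (Finset.mk_mem_product hx hy)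
  rw [hc, pow_mul, pow_mul, hN (x, y) ⟨n, hn, hxy⟩]

theorem dvd_of_isAlgClosed {L : Type*} [Field L] [IsAlgClosed L] {f h : L[X]} (hf : f ≠ 0)
    (hh : h ≠ 0) {N : ℕ} (hN : f.natDegree ≤ N)
    (hroot : ∀ x, f.IsRoot x → (X - C x) ^ N ∣ h) : f ∣ h := by
  classical
  rw [IsAlgClosed.dvd_iff_roots_le_roots hf hh, Multiset.le_iff_count]
  intro x
  rw [count_roots, count_roots]
  by_cases hx : f.IsRoot x
  · have h1 : f.rootMultiplicity x ≤ N :=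
      (count_roots f ▸ (Multiset.count_le_card x f.roots).trans (card_roots' f)).trans hN
    exact h1.trans ((le_rootMultiplicity_iff hh).2 (hroot x hx))
  · rw [rootMultiplicity_eq_zero hx]
    exact Nat.zero_le _

/-- Lagrange interpolation of `X ^ m` at the points of `B`, with `X ^ M` substituted for `X`. -/
theorem seq_eq_sum_of_charPoly_dvd {L : Type*} [Field L] [DecidableEq L] {E : LinearRecurrence L}
    {a : ℕ → L} (ha : E.IsSolution a) {M : ℕ} {B : Finset L}
    (hdvd : E.charPoly ∣ X ^ M * expand L M (∏ β ∈ B, (X - C β))) (r m : ℕ) :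
    a (r + M + M * m) = ∑ β ∈ B,
      seqFunctional a (X ^ (r + M) * expand L M (Lagrange.basis B id β)) * β ^ m := by
  have h1 : E.charPoly ∣ X ^ (r + M) * expand L M
      (X ^ m - ∑ β ∈ B, C (β ^ m) * Lagrange.basis B id β) := by
    refine hdvd.trans (mul_dvd_mul (pow_dvd_pow X (by omega)) ?_)
    obtain ⟨Q, hQ⟩ := Lagrange.prod_X_sub_C_dvd_X_pow_sub B m
    exact ⟨expand L M Q, by rw [hQ, map_mul]⟩
  have h2 := seqFunctional_eq_zero_of_dvd ha h1
  have h3 : X ^ (r + M) * expand L M (X ^ m - ∑ β ∈ B, C (β ^ m) * Lagrange.basis B id β) =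
      X ^ (r + M + M * m) -
        ∑ β ∈ B, (β ^ m) • (X ^ (r + M) * expand L M (Lagrange.basis B id β)) := by
    rw [map_sub, map_sum, mul_sub, Finset.mul_sum]
    congr 1
    · rw [map_pow, expand_X, ← pow_mul, ← pow_add]
    · refine Finset.sum_congr rfl fun β _ => ?_
      rw [map_mul, expand_C, smul_eq_C_mul, mul_left_comm]
  rw [h3, map_sub, seqFunctional_X_pow, map_sum, sub_eq_zero] at h2
  rw [h2]
  refine Finset.sum_congr rfl fun β _ => ?_
  rw [map_smul, smul_eq_mul, mul_comm]

/-- The shift by `M` in `r + M + M * m` removes the contribution of the root `0`. -/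
theorem exists_sum_pow_on_progressions {L : Type*} [Field L] [IsAlgClosed L] {p : ℕ}
    [Fact p.Prime] [CharP L p] {a : ℕ → L} {d : ℕ} (ha : SatisfiesRecurrence a d) :
    ∃ (M : ℕ) (B : Finset L) (c : ℕ → L → L), 0 < M ∧ B.card ≤ d ∧ (∀ β ∈ B, β ≠ 0) ∧
      (∀ β ∈ B, ∀ β' ∈ B, β ≠ β' → ∀ n, 0 < n → β ^ n ≠ β' ^ n) ∧
      ∀ r m, a (r + M + M * m) = ∑ β ∈ B, c r β * β ^ m := by
  classical
  obtain ⟨E, rfl, hE⟩ := ha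
  have hp : p.Prime := Fact.out
  set f := E.charPoly with hf
  have hfm : f.Monic := E.charPoly_monic
  have hfd : f.natDegree = E.order := natDegree_eq_of_degree_eq_some E.charPoly_degree_eq_order
  obtain ⟨T, hT, hTR⟩ := exists_common_torsion_exponent f.roots.toFinset
  set N := p ^ E.order with hN
  have hN0 : 0 < N := pow_pos hp.pos _
  set M := T * N with hM
  have hM0 : 0 < M := Nat.mul_pos hT hN0
  set B := (f.roots.toFinset.image (· ^ M)).erase 0 with hB
  have hBmem : ∀ β ∈ B, β ≠ 0 ∧ ∃ x ∈ f.roots.toFinset, x ^ M = β := by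
    intro β hβ
    rw [hB, Finset.mem_erase, Finset.mem_image] at hβ
    exact hβ
  have hdvd : f ∣ X ^ M * expand L M (∏ β ∈ B, (X - C β)) := by
    refine dvd_of_isAlgClosed (N := N) hfm.ne_zero ?_ ?_ fun x hx => ?_
    · refine mul_ne_zero (pow_ne_zero _ X_ne_zero) ?_
      rw [Ne, expand_eq_zero hM0]
      exact Finset.prod_ne_zero_iff.2 fun β _ => X_sub_C_ne_zero β
    · rw [hfd]
      exact (Nat.lt_pow_self hp.one_lt).le
    · by_cases hx0 : x = 0
      · rw [hx0, C_0, sub_zero]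
        exact Dvd.dvd.mul_right (pow_dvd_pow X (Nat.le_mul_of_pos_left _ hT)) _
      · refine Dvd.dvd.mul_left ?_ _
        rw [map_prod]
        have hxB : x ^ M ∈ B := by
          rw [hB, Finset.mem_erase, Finset.mem_image]
          exact ⟨pow_ne_zero _ hx0, x, by simpa [hfm.ne_zero] using hx, rfl⟩
        refine Dvd.dvd.trans ?_ (Finset.dvd_prod_of_mem _ hxB)
        have : expand L M (X - C (x ^ M)) = (X ^ T - C x ^ T) ^ N := by
          rw [hN, sub_pow_char_pow, map_sub, expand_X, expand_C, hM, pow_mul, pow_mul, C_pow, C_pow]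
        rw [this]
        exact pow_dvd_pow_of_dvd (sub_dvd_pow_sub_pow _ _ _) _
  refine ⟨M, B, fun r β => seqFunctional a (X ^ (r + M) * expand L M (Lagrange.basis B id β)),
    hM0, ?_, fun β hβ => (hBmem β hβ).1, ?_, fun r m => ?_⟩
  · calc B.card ≤ (f.roots.toFinset.image (· ^ M)).card := Finset.card_erase_le
      _ ≤ f.roots.toFinset.card := Finset.card_image_le
      _ ≤ Multiset.card f.roots := Multiset.toFinset_card_le _
      _ ≤ f.natDegree := card_roots' f
      _ = E.order := hfd
  · intro β hβ β' hβ' hne n hn h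
    obtain ⟨-, x, hx, rfl⟩ := hBmem β hβ
    obtain ⟨-, y, hy, rfl⟩ := hBmem β' hβ'
    apply hne
    rw [← pow_mul, ← pow_mul] at h
    have := hTR x hx y hy (M * n) (Nat.mul_pos hM0 hn) h
    rw [hM, pow_mul, pow_mul, this]
  · exact seq_eq_sum_of_charPoly_dvd hE hdvd r m

end Reduction

/-! ### From subspaces to windows of zeroes -/

/-- The constant is uniform in the shift `m`, which only changes the hyperplane. All coefficients and
powers are moved to the finitely generated field they generate. -/
theorem exists_card_sum_mul_pow_eq_zero_le {L : Type*} [Field L] {p : ℕ} [Fact p.Prime] [CharP L p]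
    {B : Finset L} (hB0 : ∀ β ∈ B, β ≠ 0)
    (hB : ∀ β ∈ B, ∀ β' ∈ B, β ≠ β' → ∀ n, 0 < n → β ^ n ≠ β' ^ n)
    {d : ℕ} (hBd : B.card ≤ d + 2) (c : ℕ → L → L) (M : ℕ) :
    ∃ C : ℕ, ∀ r < M, (∃ β ∈ B, c r β ≠ 0) → ∀ m N : ℕ,
      {n ∈ Set.Iio (p ^ N) | ∑ β ∈ B, c r β * β ^ (m + n) = 0}.ncard ≤ C * (N + 1) ^ d := by
  classical
  let : Algebra (ZMod p) L := ZMod.algebra L p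
  let S : Finset L := B ∪ (Finset.range M ×ˢ B).image fun q => c q.1 q.2
  let F : IntermediateField (ZMod p) L := IntermediateField.adjoin (ZMod p) (S : Set L)
  have hSF : ∀ x ∈ S, x ∈ F := fun x hx => IntermediateField.subset_adjoin _ _ hx
  have : Algebra.EssFiniteType (ZMod p) F :=
    IntermediateField.essFiniteType_iff.2 (IntermediateField.fg_adjoin_finset S)
  have : CharP F p := (RingHom.charP_iff (algebraMap F L) (algebraMap F L).injective p).2 ‹_›
  let α : B → F := fun β => ⟨β, hSF _ (Finset.mem_union_left _ β.2)⟩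
  obtain ⟨C, hC⟩ := exists_powerCount_le (K := F) (p := p)
    (fun x hx0 hx => isOfFinOrder_of_forall_exists_pow hx0 hx) d _ rfl (α := α)
    (fun β h => hB0 β β.2 (congrArg Subtype.val h))
    (fun β β' hne n hn h => hB β β.2 β' β'.2 (fun h' => hne (Subtype.ext h')) n hn
      (congrArg Subtype.val h))
  refine ⟨C, fun r hr hne m N => ?_⟩
  let γ : B → F := fun β => ⟨c r β, hSF _ (Finset.mem_union_right _ (Finset.mem_image.2
    ⟨(r, β), Finset.mk_mem_product (Finset.mem_range.2 hr) β.2, rfl⟩))⟩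
  let φ : (B → F) →ₗ[F] F := Fintype.linearCombination F fun β => γ β * α β ^ m
  have hφ : ∀ w, φ w = ∑ β, w β * (γ β * α β ^ m) := fun w => by
    simp [φ, Fintype.linearCombination_apply]
  have hW : LinearMap.ker φ ≠ ⊤ := by
    intro h
    obtain ⟨β, hβ, hcβ⟩ := hne
    have h1 : Pi.single ⟨β, hβ⟩ 1 ∈ LinearMap.ker φ := by rw [h]; trivial
    rw [LinearMap.mem_ker, hφ, Finset.sum_eq_single ⟨β, hβ⟩ (by
      intro b _ hb
      rw [Pi.single_eq_of_ne hb, zero_mul]) (by simp), Pi.single_eq_same, one_mul] at h1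
    have h2 : c r β * β ^ m = 0 := congrArg Subtype.val h1
    exact mul_ne_zero hcβ (pow_ne_zero _ (hB0 β hβ)) h2
  have hrank : Module.finrank F (LinearMap.ker φ) ≤ d + 1 := by
    have := Submodule.finrank_lt (lt_top_iff_ne_top.2 hW).ne
    rw [Module.finrank_fintype_fun_eq_card, Fintype.card_coe] at this
    omega
  refine le_trans (le_of_eq ?_) (hC _ hW hrank N)
  rw [powerCount, ← Set.ncard_coe_finset]
  congr 1
  ext n
  rw [Finset.coe_filter]
  simp only [Set.mem_ofPred, Set.mem_Iio, Finset.mem_range, LinearMap.mem_ker, hφ]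
  refine and_congr_right fun _ => ?_
  rw [← Subtype.coe_inj, ZeroMemClass.coe_zero, ← Finset.sum_coe_sort]
  push_cast
  refine Eq.congr (Finset.sum_congr rfl fun β _ => ?_) rfl
  simp only [Pi.pow_apply, SubmonoidClass.coe_pow, α, γ]
  ring

/-- A window of length `n` meets `[M, ∞)` in progressions of difference `M` with at most `n + 1`
terms each. -/
theorem Set.ncard_inter_Ico_le {S : Set ℕ} {M P D : ℕ} (hM : 0 < M) {n : ℕ} (hn : n < P)
    (hS : ∀ r < M, ∀ m, {j ∈ Set.Iio P | r + M + M * (m + j) ∈ S}.ncard ≤ D) (m : ℕ) :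
    (S ∩ Set.Ico m (m + n)).ncard ≤ M + M * D := by
  classical
  have hfin : ∀ r, {j ∈ Set.Iio P | r + M + M * (m / M - 1 + j) ∈ S}.Finite := fun r =>
    (Set.finite_Iio P).subset fun j hj => hj.1
  let f : ℕ → Finset ℕ := fun r => (hfin r).toFinset.image fun j => r + M + M * (m / M - 1 + j)
  have hsub : S ∩ Set.Ico m (m + n) ⊆
      ((Finset.range M ∪ (Finset.range M).biUnion f : Finset ℕ) : Set ℕ) := by
    rintro x ⟨hxS, hx1, hx2⟩
    rw [Finset.mem_coe, Finset.mem_union]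
    by_cases hxM : x < M
    · exact Or.inl (Finset.mem_range.2 hxM)
    · right
      have h1 : 1 ≤ x / M := (Nat.one_le_div_iff hM).2 (by omega)
      have h2 : m / M ≤ x / M := Nat.div_le_div_right hx1
      have h3 : x / M ≤ m / M + n := by
        rw [← Nat.add_mul_div_left m n hM]
        exact Nat.div_le_div_right (by nlinarith)
      have hx : x % M + M + M * (m / M - 1 + (x / M - 1 - (m / M - 1))) = x := by
        have h4 : m / M - 1 + (x / M - 1 - (m / M - 1)) = x / M - 1 := by omega
        have h5 := Nat.mod_add_div x M
        have h6 : M + M * (x / M - 1) = M * (x / M) := by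
          rw [add_comm, ← Nat.mul_succ]
          congr 1
          omega
        rw [h4, add_assoc, h6, h5]
      simp only [Finset.mem_biUnion, f, Finset.mem_image, Set.Finite.mem_toFinset]
      refine ⟨x % M, Finset.mem_range.2 (Nat.mod_lt _ hM), x / M - 1 - (m / M - 1), ⟨?_, ?_⟩, hx⟩
      · rw [Set.mem_Iio]
        omega
      · rwa [hx]
  refine (Set.ncard_le_ncard hsub (Finset.finite_toSet _)).trans ?_
  rw [Set.ncard_coe_finset]
  refine (Finset.card_union_le _ _).trans ?_
  rw [Finset.card_range]
  refine Nat.add_le_add_left (Finset.card_biUnion_le.trans ?_) _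
  refine (Finset.sum_le_card_nsmul _ _ D fun r hr => ?_).trans (by simp)
  refine Finset.card_image_le.trans ?_
  rw [← Set.ncard_eq_toFinset_card _ (hfin r)]
  exact hS r (Finset.mem_range.1 hr) _

theorem SatisfiesRecurrence.map {K L : Type*} [Field K] [Field L] (f : K →+* L) {a : ℕ → K} {d : ℕ}
    (ha : SatisfiesRecurrence a d) : SatisfiesRecurrence (fun n => f (a n)) d := by
  obtain ⟨E, rfl, hE⟩ := ha
  refine ⟨⟨E.order, fun i => f (E.coeffs i)⟩, rfl, fun n => ?_⟩
  simp only [hE n, map_sum, map_mul]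

theorem exists_windowMax_zeroSet_le {K : Type*} [Field K] {p : ℕ} [Fact p.Prime] [CharP K p]
    {a : ℕ → K} {d : ℕ} (ha : SatisfiesRecurrence a (d + 2))
    (hZ : ∀ T : Set ℕ, IsInfiniteArithProg T → ¬ T ⊆ zeroSet a) :
    ∃ C : ℕ, ∀ n, windowMax (zeroSet a) n ≤ C * (Nat.log p n + 2) ^ d := by
  have : CharP (AlgebraicClosure K) p := charP_of_injective_algebraMap
    (algebraMap K (AlgebraicClosure K)).injective p
  obtain ⟨M, B, c, hM, hBd, hB0, hB, hsum⟩ := exists_sum_pow_on_progressions (p := p)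
    (ha.map (algebraMap K (AlgebraicClosure K)))
  obtain ⟨C, hC⟩ := exists_card_sum_mul_pow_eq_zero_le (p := p) hB0 hB hBd c M
  have hzero : ∀ r j, r + M + M * j ∈ zeroSet a ↔ ∑ β ∈ B, c r β * β ^ j = 0 := by
    intro r j
    rw [← hsum, map_eq_zero_iff _ (algebraMap K (AlgebraicClosure K)).injective]
    rfl
  have hne : ∀ r, ∃ β ∈ B, c r β ≠ 0 := by
    intro r
    by_contra! h
    refine hZ _ ⟨r + M, M, hM, rfl⟩ ?_
    rintro _ ⟨i, rfl⟩
    exact (hzero r i).2 (Finset.sum_eq_zero fun β hβ => by rw [h β hβ, zero_mul])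
  refine ⟨M + M * C, fun n => ?_⟩
  obtain ⟨m, hm⟩ := (windowMax_isGreatest (zeroSet a) n).1
  rw [← hm]
  refine (Set.ncard_inter_Ico_le hM (D := C * (Nat.log p n + 2) ^ d)
    (Nat.lt_pow_succ_log_self (Fact.out : p.Prime).one_lt n) (fun r hr m => ?_) m).trans ?_
  · simp only [hzero]
    exact hC r hr (hne r) m _
  · rw [add_mul, mul_assoc]
    exact Nat.add_le_add_right (Nat.le_mul_of_pos_right _ (by positivity)) _

/-- In order at most one, a zero of `a` is followed by zeroes only. -/
theorem zeroSet_eq_empty_of_order_le_one {K : Type*} [Field K] {a : ℕ → K} {d : ℕ}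
    (ha : SatisfiesRecurrence a d) (hd : d ≤ 1)
    (hZ : ∀ T : Set ℕ, IsInfiniteArithProg T → ¬ T ⊆ zeroSet a) : zeroSet a = ∅ := by
  obtain ⟨⟨e, γ⟩, rfl, hE⟩ := ha
  simp only [LinearRecurrence.IsSolution] at hE hd
  have hstep : ∀ n, a n = 0 → a (n + 1) = 0 := by
    intro n hn
    interval_cases e
    · simpa using hE (n + 1)
    · simpa [hn] using hE n
  rw [Set.eq_empty_iff_forall_notMem]
  intro n hn
  refine hZ _ ⟨n, 1, one_pos, rfl⟩ ?_
  rintro _ ⟨i, rfl⟩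
  dsimp only
  rw [one_mul]
  induction i with
  | zero => exact hn
  | succ i ih => exact hstep _ ih

theorem natLog_add_two_le {p n : ℕ} (hp : 2 ≤ p) (hn : 3 ≤ n) :
    ((Nat.log p n + 2 : ℕ) : ℝ) ≤ 4 * Real.log n ∧ 1 ≤ Real.log n := by
  have hn' : (3 : ℝ) ≤ n := by exact_mod_cast hn
  have h1 : 1 ≤ Real.log n := by
    rw [Real.le_log_iff_exp_le (by linarith)]
    linarith [Real.exp_one_lt_d9]
  refine ⟨?_, h1⟩
  have h2 : (p : ℝ) ^ Nat.log p n ≤ n := by exact_mod_cast Nat.pow_log_le_self p (by omega)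
  have h3 : (2 : ℝ) ^ Nat.log p n ≤ n := by
    refine le_trans ?_ h2
    gcongr
    exact_mod_cast hp
  have h4 := Real.log_le_log (by positivity) h3
  rw [Real.log_pow] at h4
  have h5 := Real.log_two_gt_d9
  push_cast
  nlinarith [(Nat.cast_nonneg (Nat.log p n) : (0 : ℝ) ≤ Nat.log p n)]

theorem corollary1p6 {K : Type*} [Field K] (p : ℕ) [CharP K p] (hp : 0 < p)
    (a : ℕ → K) (d : ℕ) (ha : IsRecurrenceSeqOfOrder a d)
    (hZ : ∀ T : Set ℕ, IsInfiniteArithProg T → ¬ T ⊆ zeroSet a) :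
    (fun n : ℕ => (windowMax (zeroSet a) n : ℝ)) =O[atTop]
      (fun n : ℕ => Real.log (n : ℝ) ^ ((d : ℤ) - 2)) := by
  have hprime : Fact p.Prime := ⟨(CharP.char_is_prime_or_zero K p).resolve_right hp.ne'⟩
  have hrec : SatisfiesRecurrence a d := ha.1
  rcases Nat.lt_or_ge 1 d with hd | hd
  · obtain ⟨k, rfl⟩ : ∃ k, d = k + 2 := ⟨d - 2, by omega⟩
    obtain ⟨C, hC⟩ := exists_windowMax_zeroSet_le (p := p) hrec hZ
    refine IsBigO.of_bound (C * 4 ^ k) ?_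
    filter_upwards [eventually_ge_atTop 3] with n hn
    obtain ⟨h1, h2⟩ := natLog_add_two_le hprime.out.two_le hn
    have h3 : ((k + 2 : ℕ) : ℤ) - 2 = (k : ℕ) := by push_cast; ring
    rw [h3, zpow_natCast, Real.norm_of_nonneg (Nat.cast_nonneg _),
      Real.norm_of_nonneg (by positivity)]
    calc (windowMax (zeroSet a) n : ℝ) ≤ ((C * (Nat.log p n + 2) ^ k : ℕ) : ℝ) := by
          exact_mod_cast hC n
      _ = C * ((Nat.log p n + 2 : ℕ) : ℝ) ^ k := by push_cast; ring
      _ ≤ C * (4 * Real.log n) ^ k := by gcongr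
      _ = C * 4 ^ k * Real.log n ^ k := by rw [mul_pow, mul_assoc]
  · have h0 := zeroSet_eq_empty_of_order_le_one hrec hd hZ
    have h1 : ∀ n, windowMax (zeroSet a) n = 0 := by
      intro n
      simp [windowMax, h0]
    simp only [h1, Nat.cast_zero]
    exact isBigO_zero _ _
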